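/- **Definitions.** Let $S$ be a finite set. A *finitary $S$-sorted clone* $M$ consists of sets $M_{(n,v,s)}$ for all $n\in\mathbb N$, $v:\{0,\dots,n-1\}\to S$, $s\in S$ (operations with $n$ variables of sorts $v(0),\dots,v(n-1)$ and value of sort $s$), projections $\pi_{(n,v,i)}\in M_{(n,v,v(i))}$, and compositions $M_{(m,v,s)}\times\prod_{i<m}M_{(n,w,v(i))}\to M_{(n,w,s)}$, $(f,(g_i)_i)\mapsto f(g_i)_{i}$, such that $f(g_i(h_j)_j)_i=(f(g_i)_i)(h_j)_j$, $\pi_{(m,v,i)}(g_j)_j=g_i$ and $f(\pi_{(n,v,i)})_i=f$. For a finite set $X$ and $v:X\to S$, $M_{(X,v,s)}$ denotes $M_{(|X|,v\circ\varphi^{-1},s)}$ for a fixed bijection $\varphi:X\to\{0,\dots,|X|-1\}$, with projections $\pi_{(X,v,x)}$, $x\in X$. We write $M_{ns\to t}$ if $v$ is constant with value $s$. The clone $M$ is *pure* if $M_{1s\to t}\ne\emptyset$ for all $s,t\in S$. An *$M$-algebra* is a family of sets $(A_s)_{s\in S}$ on which each $f\in M_{(n,v,s)}$ acts as a map $\prod_{i<n}A_{v(i)}\to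 A_s$, compatibly with compositions and such that projections act as projections; $\mathcal V(M)$ is the class of all $M$-algebras. A *congruence* of $A$ is a family of equivalence relations $\theta_s$ on $A_s$ ($s\in S$) preserved by all operations; $\mathcal V(M)$ is *congruence distributive* if $\theta\wedge(\eta\vee\zeta)=(\theta\wedge\eta)\vee(\theta\wedge\zeta)$ in the lattice of congruences of each $A\in\mathcal V(M)$. The *homogenization* ${\rm H}(M)$ is the single-sorted finitary clone with ${\rm H}_n(M)=\prod_{s\in S}M_{(n\times S,p_2,s)}$, where $n=\{0,\dots,n-1\}$ and $p_2$ is the second projection, with projections $\pi_{(n,i)}=(\pi_{(n\times S,p_2,(i,s))})_{s\in S}$ and composition $f(g_i)_{i<m}=(f_s(g_{i,t})_{(i,t)\in m\times S})_{s\in S}$. For $f\in M_{3s\to s}$ and $i,j,k\in\{0,1,2\}$ let $f[i,j,k]=f(\pi_{i},\pi_{j},\pi_{k})\in M_{3s\to s}$, where $\pi_i$ is the $i$-th projection in $M_{3s\to s}$, and similarly for $f\in{\rm H}_3(M)$. For $f\in M_{(3\times S,p_2,s)}$ let $f[i,j,k]=f\big((\pi_{(i,t)})_{t\in S},(\pi_{(j,t)})_{t\in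 S},(\pi_{(k,t)})_{t\in S}\big)\in M_{(3\times S,p_2,s)}$, where $\pi_{(i,t)}=\pi_{(3\times S,p_2,(i,t))}$. *Jónsson terms of length $n\ge 0$* in ${\rm H}_3(M)$, in $M_{3s\to s}$, or in $M_{(3\times S,p_2,s)}$ (*sortwise* Jónsson terms for $s$) are elements $d_0,\dots,d_{2n}$ of that set such that $$d_i[0,1,0]=d_{i+1}[0,1,0]\ (0\le i<2n),\quad d_{2i}[0,0,2]=d_{2i+1}[0,0,2]\ (0\le i<n),\quad d_{2i+1}[0,2,2]=d_{2i+2}[0,2,2]\ (0\le i<n),$$ and $d_0$ and $d_{2n}$ are the projections $\pi_{(3,0)},\pi_{(3,2)}$ in the case of ${\rm H}_3(M)$; $\pi_0,\pi_2$ in the case of $M_{3s\to s}$; and $\pi_{(0,s)},\pi_{(2,s)}$ in the case of $M_{(3\times S,p_2,s)}$. **Theorem.** Let $S$ be a finite set and let $M$ be a pure finitary $S$-sorted clone. Then the following are equivalent: 1. $\mathcal V(M)$ is congruence distributive. 2. $\mathcal V({\rm H}(M))$ is congruence distributive. 3. There is $n\ge0$ such that ${\rm H}_3(M)$ contains Jónsson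 terms of length $n$. 4. There is $n\ge0$ such that, for each $s\in S$, $M_{(3\times S,p_2,s)}$ contains sortwise Jónsson terms of length $n$. 5. For each $s\in S$ there is $n\ge0$ such that $M_{(3\times S,p_2,s)}$ contains sortwise Jónsson terms of length $n$. 6. For each $s\in S$ there is $n\ge0$ such that $M_{3s\to s}$ contains Jónsson terms of length $n$. -/

import Mathlib

universe u v w x y z

namespace ManySorted

/-- A finitary `S`-sorted clone. `Op v s` is the set of operations of sort
`(v 0, ..., v (n - 1)) → s`, where `v : Fin n → S`. -/
structure Clone (S : Type u) where
  Op : {n : ℕ} → (Fin n → S) → S → Type v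
  proj : {n : ℕ} → (v : Fin n → S) → (i : Fin n) → Op v (v i)
  comp : {m n : ℕ} → {v : Fin m → S} → {w : Fin n → S} → {s : S} →
    Op v s → ((i : Fin m) → Op w (v i)) → Op w s
  assoc : ∀ {l m n : ℕ} {u : Fin l → S} {v : Fin m → S} {w : Fin n → S} {s : S}
    (f : Op u s) (g : (i : Fin l) → Op v (u i)) (h : (j : Fin m) → Op w (v j)),
    comp f (fun i => comp (g i) h) = comp (comp f g) h
  proj_comp : ∀ {m n : ℕ} {v : Fin m → S} {w : Fin n → S} (i : Fin m)
    (g : (i : Fin m) → Op w (v i)), comp (proj v i) g = g i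
  comp_proj : ∀ {n : ℕ} {v : Fin n → S} {s : S} (f : Op v s), comp f (proj v) = f

namespace Clone

variable {S : Type u} (M : Clone.{u, v} S)

/-- A clone is pure if there is a unary operation `s → t` for all sorts `s` and `t`. -/
def IsPure : Prop :=
  ∀ s t : S, Nonempty (M.Op (fun _ : Fin 1 => s) t)

/-! ### Operations whose variables are indexed by an arbitrary finite set

For a finite set `X`, the operations with variables indexed by `X` are the operations of arity
`|X|`, along a fixed bijection between `X` and `Fin |X|`. -/

section Indexed

variable {X : Type x} {Y : Type y} {Z : Type z} [Finite X] [Finite Y] [Finite Z]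

/-- Operations of sort `(X, v, s)` for a finite set `X`. -/
abbrev OpOn (v : X → S) (s : S) : Type v :=
  M.Op (fun i => v ((Finite.equivFin X).symm i)) s

/-- The projection `π_{(X, v, x)}`; the rewriting only identifies the sort
`v (e.symm (e x))` with `v x`. -/
noncomputable def projOn (v : X → S) (x : X) : M.OpOn v (v x) :=
  cast (congrArg (fun y => M.OpOn v (v y)) ((Finite.equivFin X).symm_apply_apply x))
    (M.proj (fun i => v ((Finite.equivFin X).symm i)) (Finite.equivFin X x))

/-- Composition for operations with variables indexed by finite sets. -/
noncomputable def compOn {v : X → S} {w : Y → S} {s : S} (f : M.OpOn v s)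
    (g : (x : X) → M.OpOn w (v x)) : M.OpOn w s :=
  M.comp f (fun i => g ((Finite.equivFin X).symm i))

theorem projOn_symm (v : X → S) (i : Fin (Nat.card X)) :
    M.projOn v ((Finite.equivFin X).symm i) =
      M.proj (fun i => v ((Finite.equivFin X).symm i)) i := by
  unfold projOn
  apply eq_of_heq
  refine (cast_heq _ _).trans ?_
  rw [Equiv.apply_symm_apply (Finite.equivFin X) i]

theorem compOn_assoc {v : X → S} {w : Y → S} {z : Z → S} {s : S} (f : M.OpOn v s)
    (g : (x : X) → M.OpOn w (v x)) (h : (y : Y) → M.OpOn z (w y)) :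
    M.compOn f (fun x => M.compOn (g x) h) = M.compOn (M.compOn f g) h :=
  M.assoc _ _ _

theorem projOn_compOn {v : X → S} {w : Y → S} (x : X) (g : (x : X) → M.OpOn w (v x)) :
    M.compOn (M.projOn v x) g = g x := by
  obtain ⟨i, rfl⟩ := (Finite.equivFin X).symm.surjective x
  rw [projOn_symm]
  exact M.proj_comp i _

theorem compOn_projOn {v : X → S} {s : S} (f : M.OpOn v s) :
    M.compOn f (M.projOn v) = f := by
  unfold compOn
  simp only [projOn_symm]
  exact M.comp_proj f

end Indexed

/-- The homogenization `H(M)` of a clone `M` with finitely many sorts: an `n`-ary operation is a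
family `(f_t)` with `f_t` of sort `(Fin n × S, p₂, t)`. It is a single-sorted clone. -/
noncomputable def homogenization [Finite S] : Clone.{0, max u v} Unit where
  Op := fun {n} _ _ => (t : S) → M.OpOn (fun x : Fin n × S => x.2) t
  proj := fun _ i t => M.projOn _ (i, t)
  comp := fun f g t => M.compOn (f t) (fun x => g x.1 x.2)
  assoc := fun _ _ _ => funext fun _ => M.compOn_assoc _ _ _
  proj_comp := fun _ _ => funext fun _ => M.projOn_compOn _ _
  comp_proj := fun _ => funext fun _ => M.compOn_projOn _

/-- Algebras of a clone, i.e. the members of the variety `V(M)`. -/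
structure Alg where
  carrier : S → Type w
  act : {n : ℕ} → {v : Fin n → S} → {s : S} → M.Op v s →
    ((i : Fin n) → carrier (v i)) → carrier s
  act_proj : ∀ {n : ℕ} (v : Fin n → S) (i : Fin n) (a : (i : Fin n) → carrier (v i)),
    act (M.proj v i) a = a i
  act_comp : ∀ {m n : ℕ} {v : Fin m → S} {w : Fin n → S} {s : S} (f : M.Op v s)
    (g : (i : Fin m) → M.Op w (v i)) (a : (j : Fin n) → carrier (w j)),
    act (M.comp f g) a = act f (fun i => act (g i) a)

end Clone

/-- A congruence of an algebra: a sortwise equivalence relation preserved by all operations. -/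
@[ext]
structure Congruence {S : Type u} {M : Clone.{u, v} S} (A : Clone.Alg.{u, v, w} M) where
  rel : (s : S) → Setoid (A.carrier s)
  compat : ∀ {n : ℕ} {v : Fin n → S} {s : S} (f : M.Op v s)
    (a b : (i : Fin n) → A.carrier (v i)),
    (∀ i, (rel (v i)) (a i) (b i)) → (rel s) (A.act f a) (A.act f b)

namespace Congruence

variable {S : Type u} {M : Clone.{u, v} S} {A : Clone.Alg.{u, v, w} M}

/-- Congruences are ordered by sortwise inclusion. -/
instance : PartialOrder (Congruence A) :=
  PartialOrder.lift rel fun _ _ h => Congruence.ext h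

/-- The sortwise intersection of a set of congruences. -/
def inter (C : Set (Congruence A)) : Congruence A where
  rel := fun s => sInf ((fun θ => θ.rel s) '' C)
  compat := by
    rintro n v s f a b h _ ⟨θ, hθ, rfl⟩
    exact θ.compat f a b fun i => h i _ ⟨θ, hθ, rfl⟩

theorem inter_le {C : Set (Congruence A)} {θ : Congruence A} (h : θ ∈ C) : inter C ≤ θ :=
  fun s _ _ hxy => hxy (θ.rel s) ⟨θ, h, rfl⟩

theorem le_inter {C : Set (Congruence A)} {θ : Congruence A} (h : ∀ η ∈ C, θ ≤ η) :
    θ ≤ inter C := by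
  rintro s x y hxy _ ⟨η, hη, rfl⟩
  exact h η hη s hxy

/-- The lattice of congruences: meets are sortwise intersections, the join of `θ` and `η` is the
least congruence that contains both. -/
instance : Lattice (Congruence A) where
  inf := fun θ η =>
    { rel := fun s => θ.rel s ⊓ η.rel s
      compat := fun f a b h =>
        ⟨θ.compat f a b fun i => (h i).1, η.compat f a b fun i => (h i).2⟩ }
  inf_le_left := fun _ _ _ _ _ h => h.1
  inf_le_right := fun _ _ _ _ _ h => h.2
  le_inf := fun _ _ _ h₁ h₂ s _ _ h => ⟨h₁ s h, h₂ s h⟩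
  sup := fun θ η => inter {ζ | θ ≤ ζ ∧ η ≤ ζ}
  le_sup_left := fun _ _ => le_inter fun _ h => h.1
  le_sup_right := fun _ _ => le_inter fun _ h => h.2
  sup_le := fun _ _ _ h₁ h₂ => inter_le ⟨h₁, h₂⟩

end Congruence

namespace Clone

variable {S : Type u} (M : Clone.{u, v} S)

/-- The variety `V(M)` is congruence distributive: the congruence lattice of every `M`-algebra
(with carriers in `Type w`) is distributive. -/
def CongruenceDistributive : Prop :=
  ∀ (A : Alg.{u, v, w} M) (θ η ζ : Congruence A), θ ⊓ (η ⊔ ζ) = (θ ⊓ η) ⊔ (θ ⊓ ζ)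

/-- For `f ∈ M_{3s → s}`, the operation `f(π_i, π_j, π_k) ∈ M_{3s → s}`. -/
def subst {s : S} (f : M.Op (fun _ : Fin 3 => s) s) (i j k : Fin 3) :
    M.Op (fun _ : Fin 3 => s) s :=
  M.comp f (fun a => M.proj (fun _ : Fin 3 => s) (![i, j, k] a))

/-- There are Jónsson terms `d_0, ..., d_{2n}` of length `n` in `M_{3s → s}`.
The values of `d` beyond `2n` are irrelevant. -/
def HasJonssonTerms (s : S) (n : ℕ) : Prop :=
  ∃ d : ℕ → M.Op (fun _ : Fin 3 => s) s,
    d 0 = M.proj (fun _ => s) 0 ∧ d (2 * n) = M.proj (fun _ => s) 2 ∧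
    (∀ i < 2 * n, M.subst (d i) 0 1 0 = M.subst (d (i + 1)) 0 1 0) ∧
    (∀ i < n, M.subst (d (2 * i)) 0 0 2 = M.subst (d (2 * i + 1)) 0 0 2) ∧
    (∀ i < n, M.subst (d (2 * i + 1)) 0 2 2 = M.subst (d (2 * i + 2)) 0 2 2)

section Sortwise

variable [Finite S]

/-- The sort `(3 × S, p₂, s)` of `M`. -/
abbrev OpThree (s : S) : Type v :=
  M.OpOn (fun x : Fin 3 × S => x.2) s

/-- The projection `π_{(3 × S, p₂, (i, t))}`. -/
noncomputable abbrev projThree (i : Fin 3) (t : S) : M.OpThree t :=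
  M.projOn (fun x : Fin 3 × S => x.2) (i, t)

/-- For `f` of sort `(3 × S, p₂, s)`, the operation `f((π_{(i,t)})_t, (π_{(j,t)})_t, (π_{(k,t)})_t)`
of the same sort. -/
noncomputable def substThree {s : S} (f : M.OpThree s) (i j k : Fin 3) : M.OpThree s :=
  M.compOn f (fun x => M.projThree (![i, j, k] x.1) x.2)

/-- There are sortwise Jónsson terms `d_0, ..., d_{2n}` of length `n` in `M_{(3 × S, p₂, s)}`.
The values of `d` beyond `2n` are irrelevant. -/
def HasSortwiseJonssonTerms (s : S) (n : ℕ) : Prop :=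
  ∃ d : ℕ → M.OpThree s,
    d 0 = M.projThree 0 s ∧ d (2 * n) = M.projThree 2 s ∧
    (∀ i < 2 * n, M.substThree (d i) 0 1 0 = M.substThree (d (i + 1)) 0 1 0) ∧
    (∀ i < n, M.substThree (d (2 * i)) 0 0 2 = M.substThree (d (2 * i + 1)) 0 0 2) ∧
    (∀ i < n, M.substThree (d (2 * i + 1)) 0 2 2 = M.substThree (d (2 * i + 2)) 0 2 2)

end Sortwise

end Clone

end ManySorted

namespace ManySorted

/-! Jónsson's theorem works one sort at a time. Joins of congruences are sortwise chains
(`sup_rel_iff`), so distributivity at sort `s` involves only ternary operations `3s → s`; this gives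
1 ⇔ 6 and, applied to the one-sorted clone `H(M)`, 2 ⇔ 3 (`congruenceDistributive_iff`). An element
of `H_3(M)` is a family of sortwise operations and the identities are componentwise, whence 3 ⇔ 4.
Jónsson terms can be padded and `S` is finite, so a common length exists: 4 ⇔ 5. For 5 ⇒ 6, purity
supplies unary `u_t : s → t`, and `u_t(π_i)` is substituted for the variable `(i, t)`. For 6 ⇒ 5,
variables of sorts other than `s` are added as dummies. -/

/-- Two elements in the join of two equivalence relations are connected by an alternating chain. -/
theorem exists_alternating_chain {T : Type x} (α β : Setoid T) {a b : T}
    (h : Relation.ReflTransGen (fun x y => α x y ∨ β x y) a b) :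
    ∃ (n : ℕ) (d : ℕ → T), d 0 = a ∧ d (2 * n) = b ∧
      (∀ i < n, α (d (2 * i)) (d (2 * i + 1))) ∧
      (∀ i < n, β (d (2 * i + 1)) (d (2 * i + 2))) := by
  induction h using Relation.ReflTransGen.head_induction_on with
  | refl => exact ⟨0, fun _ => b, rfl, rfl, by simp, by simp⟩
  | @head a c hac _ ih =>
    obtain ⟨n, d, h0, hn, hα, hβ⟩ := ih
    -- Any single step becomes an `α`-step followed by a `β`-step, one of them trivial.
    obtain ⟨m, ham, hmc⟩ : ∃ m, α a m ∧ β m c :=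
      hac.elim (fun h => ⟨c, h, β.refl c⟩) (fun h => ⟨a, α.refl a, h⟩)
    refine ⟨n + 1, fun i => Nat.casesOn i a fun i => Nat.casesOn i m d, rfl, hn, ?_, ?_⟩
    · rintro (_ | i) hi
      · exact ham
      · exact hα i (by omega)
    · rintro (_ | i) hi
      · change β m (d 0)
        rwa [h0]
      · exact hβ i (by omega)

/-- A function of finitely many variables that respects equivalence relations in each variable
respects them jointly. -/
theorem rel_of_rel_update {ι : Type x} [Finite ι] {T : ι → Type y} {B : Type z}
    (E : (i : ι) → T i → T i → Prop) (R : Setoid B) (f : ((i : ι) → T i) → B)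
    (hf : ∀ [DecidableEq ι] (a : (i : ι) → T i) (i : ι) (y : T i), E i (a i) y →
      R (f a) (f (Function.update a i y)))
    (a b : (i : ι) → T i) (hab : ∀ i, E i (a i) (b i)) : R (f a) (f b) := by
  classical
  cases nonempty_fintype ι
  have key : ∀ s : Finset ι, R (f a) (f (s.piecewise b a)) := by
    intro s
    induction s using Finset.induction_on with
    | empty => simp
    | @insert i s hi ih =>
      rw [Finset.piecewise_insert]
      refine R.trans ih (hf _ i _ ?_)
      rw [Finset.piecewise_eq_of_notMem _ _ _ hi]
      exact hab i
  simpa using key Finset.univ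

/-! ### Joins of congruences -/

namespace Congruence

variable {S : Type u} {M : Clone.{u, v} S} {A : Clone.Alg.{u, v, w} M}

/-- The congruence of pairs connected by a chain of steps in `η` or `ζ`. -/
def chain (η ζ : Congruence A) : Congruence A where
  rel := fun s =>
    haveI : Std.Symm fun x y => η.rel s x y ∨ ζ.rel s x y :=
      ⟨fun _ _ h => h.imp (η.rel s).symm (ζ.rel s).symm⟩
    { r := Relation.ReflTransGen fun x y => η.rel s x y ∨ ζ.rel s x y
      iseqv :=
        ⟨fun _ => .refl,
          fun h => (Relation.ReflTransGen.stdSymm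
            (r := fun x y => η.rel s x y ∨ ζ.rel s x y)).symm _ _ h,
          fun h₁ h₂ => h₁.trans h₂⟩ }
  compat := by
    intro n v s f a b hab
    refine rel_of_rel_update
      (fun i => Relation.ReflTransGen fun x y => η.rel (v i) x y ∨ ζ.rel (v i) x y)
      _ (A.act f) ?_ a b hab
    intro _ a i y h
    have step (θ : Congruence A) {x y : A.carrier (v i)} (hxy : θ.rel (v i) x y) :
        θ.rel s (A.act f (Function.update a i x)) (A.act f (Function.update a i y)) := by
      refine θ.compat f _ _ fun j => ?_
      obtain rfl | hj := eq_or_ne j i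
      · simpa using hxy
      · simp [hj]
    have h' := Relation.ReflTransGen.lift (p := fun x y => η.rel s x y ∨ ζ.rel s x y)
      (fun x => A.act f (Function.update a i x))
      (fun x y hxy => hxy.imp (step η) (step ζ)) _ _ h
    simpa only [Function.onFun, Function.update_eq_self] using h'

/-- Chains already form a congruence because operations are finitary: arguments can be changed one
at a time. -/
theorem sup_rel_iff (η ζ : Congruence A) (s : S) (x y : A.carrier s) :
    (η ⊔ ζ).rel s x y ↔ Relation.ReflTransGen (fun x y => η.rel s x y ∨ ζ.rel s x y) x y := by
  constructor
  · intro h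
    have hle : η ⊔ ζ ≤ chain η ζ :=
      sup_le (fun s x y h => .single (.inl h)) (fun s x y h => .single (.inr h))
    exact hle s h
  · intro h
    induction h with
    | refl => exact ((η ⊔ ζ).rel s).refl x
    | tail _ h ih =>
      refine ((η ⊔ ζ).rel s).trans ih ?_
      exact h.elim (fun h => (le_sup_left : η ≤ η ⊔ ζ) s h)
        (fun h => (le_sup_right : ζ ≤ η ⊔ ζ) s h)

end Congruence

namespace Clone

/-! ### Jónsson's theorem for many-sorted clones -/

section Jonsson

variable {S : Type u} (M : Clone.{u, v} S)

/-- The free algebra on variables of sorts `v`, lifted to a larger universe. -/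
def freeAlg {n : ℕ} (a : Fin n → S) : Alg.{u, v, max v w} M where
  carrier := fun t => ULift.{w} (M.Op a t)
  act := fun f g => ⟨M.comp f fun i => (g i).down⟩
  act_proj := fun _ i g => congrArg ULift.up (M.proj_comp i fun i => (g i).down)
  act_comp := fun f g h => congrArg ULift.up (M.assoc f g fun i => (h i).down).symm

/-- The kernel of the homomorphism between free algebras given by a substitution. -/
def substKer {m n : ℕ} {a : Fin m → S} {b : Fin n → S} (σ : (i : Fin m) → M.Op b (a i)) :
    Congruence (freeAlg.{u, v, w} M a) where
  rel := fun _ => Setoid.ker fun f => M.comp f.down σ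
  compat := by
    intro k c s f g h hgh
    change M.comp (M.comp f fun i => (g i).down) σ = M.comp (M.comp f fun i => (h i).down) σ
    rw [← M.assoc, ← M.assoc]
    exact congrArg (M.comp f) (funext hgh)

variable {M}

/-- In the free algebra on three generators of sort `s`, distributivity turns the path `P 0`, `P 1`,
`P 2` into a chain inside `K 0 1 0`, and the members of that chain are the Jónsson terms. -/
theorem CongruenceDistributive.exists_hasJonssonTerms
    (h : CongruenceDistributive.{u, v, max v w} M) (s : S) : ∃ n, M.HasJonssonTerms s n := by
  let K (i j k : Fin 3) : Congruence (freeAlg.{u, v, w} M fun _ : Fin 3 => s) :=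
    substKer M fun a => M.proj (fun _ : Fin 3 => s) (![i, j, k] a)
  let P (i : Fin 3) : (freeAlg.{u, v, w} M fun _ : Fin 3 => s).carrier s :=
    ⟨M.proj (fun _ : Fin 3 => s) i⟩
  have hP (i j k a b : Fin 3) (hab : ![i, j, k] a = ![i, j, k] b) :
      (K i j k).rel s (P a) (P b) := by
    change M.comp (M.proj (fun _ : Fin 3 => s) a) _ = M.comp (M.proj (fun _ : Fin 3 => s) b) _
    rw [M.proj_comp, M.proj_comp, hab]
  have h1 : (K 0 1 0 ⊓ (K 0 0 2 ⊔ K 0 2 2)).rel s (P 0) (P 2) := by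
    refine ⟨hP 0 1 0 0 2 rfl, ?_⟩
    exact ((K 0 0 2 ⊔ K 0 2 2).rel s).trans
      ((le_sup_left : K 0 0 2 ≤ K 0 0 2 ⊔ K 0 2 2) s (hP 0 0 2 0 1 rfl))
      ((le_sup_right : K 0 2 2 ≤ K 0 0 2 ⊔ K 0 2 2) s (hP 0 2 2 1 2 rfl))
  rw [h, Congruence.sup_rel_iff] at h1
  obtain ⟨n, d, h0, hn, hα, hβ⟩ := exists_alternating_chain _ _ h1
  refine ⟨n, fun i => (d i).down, congrArg ULift.down h0, congrArg ULift.down hn, ?_,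
    fun i hi => (hα i hi).2, fun i hi => (hβ i hi).2⟩
  intro i hi
  obtain ⟨j, rfl | rfl⟩ := Nat.even_or_odd' i
  · exact (hα j (by omega)).1
  · exact (hβ j (by omega)).1

theorem act_subst (A : Alg.{u, v, w} M) {s : S} (f : M.Op (fun _ : Fin 3 => s) s) (i j k : Fin 3)
    (a : Fin 3 → A.carrier s) :
    A.act (M.subst f i j k) a = A.act f ![a i, a j, a k] := by
  unfold subst
  rw [A.act_comp]
  refine congrArg (A.act f) (funext fun l => ?_)
  rw [A.act_proj (fun _ : Fin 3 => s)]
  fin_cases l <;> rfl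

theorem congruenceDistributive_of_hasJonssonTerms (h : ∀ s, ∃ n, M.HasJonssonTerms s n) :
    CongruenceDistributive.{u, v, w} M := by
  intro A θ η ζ
  refine le_antisymm ?_ le_inf_sup
  intro s a b hab
  obtain ⟨n, d, h0, hn, h010, h002, h022⟩ := h s
  let D (i : ℕ) (x y z : A.carrier s) : A.carrier s := A.act (d i) ![x, y, z]
  have hD0 (x y z) : D 0 x y z = x := by
    simp only [D, h0]
    exact A.act_proj (fun _ : Fin 3 => s) 0 _
  have hDn (x y z) : D (2 * n) x y z = z := by
    simp only [D, hn]
    exact A.act_proj (fun _ : Fin 3 => s) 2 _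
  have hD010 (x y) : ∀ i ≤ 2 * n, D i x y x = x := by
    intro i
    induction i with
    | zero => exact fun _ => hD0 x y x
    | succ i ih =>
      intro hi
      have := congrArg (fun f => A.act f ![x, y, x]) (h010 i hi)
      simp only [act_subst] at this
      exact this.symm.trans (ih (by omega))
  have hD002 (i) (hi : i < n) (x y) : D (2 * i) x x y = D (2 * i + 1) x x y := by
    have := congrArg (fun f => A.act f ![x, x, y]) (h002 i hi)
    simp only [act_subst] at this
    exact this
  have hD022 (i) (hi : i < n) (x y) : D (2 * i + 1) x y y = D (2 * i + 2) x y y := by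
    have := congrArg (fun f => A.act f ![x, y, y]) (h022 i hi)
    simp only [act_subst] at this
    exact this
  have hcompat (κ : Congruence A) (i) {x x' y y' z z' : A.carrier s} (hx : κ.rel s x x')
      (hy : κ.rel s y y') (hz : κ.rel s z z') : κ.rel s (D i x y z) (D i x' y' z') := by
    refine κ.compat (d i) _ _ fun l => ?_
    fin_cases l
    exacts [hx, hy, hz]
  set κ := (θ ⊓ η) ⊔ (θ ⊓ ζ) with hκ
  -- `D i a x b` is `θ`-related to `D i a x a = a` for every `x`, even if `x` is not `θ`-related to
  -- `a`.
  have hθ (i) (hi : i ≤ 2 * n) (x) : θ.rel s (D i a x b) a := by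
    have := hcompat θ i ((θ.rel s).refl a) ((θ.rel s).refl x) ((θ.rel s).symm hab.1)
    rwa [hD010 a x i hi] at this
  -- The map `x ↦ D i a x b` sends a chain from `a` to `b` into a single `θ`-class.
  have hmid (i) (hi : i ≤ 2 * n) : κ.rel s (D i a a b) (D i a b b) := by
    have h := (Congruence.sup_rel_iff η ζ s a b).1 hab.2
    rw [hκ, Congruence.sup_rel_iff]
    refine Relation.ReflTransGen.lift (fun x => D i a x b) (fun x y hxy => ?_) _ _ h
    have hxyθ := (θ.rel s).trans (hθ i hi x) ((θ.rel s).symm (hθ i hi y))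
    exact hxy.imp (fun h => ⟨hxyθ, hcompat η i ((η.rel s).refl a) h ((η.rel s).refl b)⟩)
      (fun h => ⟨hxyθ, hcompat ζ i ((ζ.rel s).refl a) h ((ζ.rel s).refl b)⟩)
  -- Cross to the next term at `(a, a, b)`, move to `(a, b, b)` by `hmid`, cross again, and move
  -- back.
  have hchain : ∀ i ≤ n, κ.rel s a (D (2 * i) a a b) := by
    intro i
    induction i with
    | zero =>
      intro _
      rw [Nat.mul_zero, hD0]
    | succ i ih =>
      intro hi
      refine (κ.rel s).trans (ih (by omega)) ?_
      rw [hD002 i hi]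
      refine (κ.rel s).trans (hmid (2 * i + 1) (by omega)) ?_
      rw [hD022 i hi]
      exact (κ.rel s).symm (hmid (2 * i + 2) (by omega))
  simpa only [hDn] using hchain n le_rfl

theorem congruenceDistributive_iff :
    CongruenceDistributive.{u, v, max v w} M ↔ ∀ s, ∃ n, M.HasJonssonTerms s n :=
  ⟨CongruenceDistributive.exists_hasJonssonTerms.{u, v, w},
    congruenceDistributive_of_hasJonssonTerms⟩

end Jonsson

/-! ### Homogenization and sortwise Jónsson terms -/

section Sortwise

variable {S : Type u} [Finite S] {M : Clone.{u, v} S}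

theorem homogenization_hasJonssonTerms_iff (n : ℕ) :
    M.homogenization.HasJonssonTerms () n ↔ ∀ s, M.HasSortwiseJonssonTerms s n := by
  constructor
  · rintro ⟨d, h0, hn, h010, h002, h022⟩ s
    exact ⟨fun i => d i s, congrFun h0 s, congrFun hn s, fun i hi => congrFun (h010 i hi) s,
      fun i hi => congrFun (h002 i hi) s, fun i hi => congrFun (h022 i hi) s⟩
  · intro h
    choose d h0 hn h010 h002 h022 using h
    exact ⟨fun i s => d s i, funext h0, funext hn, fun i hi => funext fun s => h010 s i hi,
      fun i hi => funext fun s => h002 s i hi, fun i hi => funext fun s => h022 s i hi⟩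

theorem HasSortwiseJonssonTerms.mono {s : S} {m n : ℕ} (h : M.HasSortwiseJonssonTerms s m)
    (hmn : m ≤ n) : M.HasSortwiseJonssonTerms s n := by
  obtain ⟨d, h0, hm, h010, h002, h022⟩ := h
  have hlt {i} (hi : i ≤ 2 * m) : d (min i (2 * m)) = d i := by rw [min_eq_left hi]
  have hge {i} (hi : 2 * m ≤ i) : d (min i (2 * m)) = d (2 * m) := by rw [min_eq_right hi]
  -- The last term is repeated. As `2 * m` is even, no pair in the alternating identities straddles
  -- the cutoff.
  refine ⟨fun i => d (min i (2 * m)), ?_, ?_, fun i _ => ?_, fun i _ => ?_, fun i _ => ?_⟩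
  · simpa using h0
  · simpa only [hge (show 2 * m ≤ 2 * n by omega)] using hm
  · obtain hi | hi := lt_or_ge i (2 * m)
    · simpa only [hlt hi.le, hlt (show i + 1 ≤ 2 * m from hi)] using h010 i hi
    · simp only [hge hi, hge (show 2 * m ≤ i + 1 by omega)]
  · obtain hi | hi := lt_or_ge i m
    · simpa only [hlt (show 2 * i ≤ 2 * m by omega), hlt (show 2 * i + 1 ≤ 2 * m by omega)]
        using h002 i hi
    · simp only [hge (show 2 * m ≤ 2 * i by omega), hge (show 2 * m ≤ 2 * i + 1 by omega)]
  · obtain hi | hi := lt_or_ge i m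
    · simpa only [hlt (show 2 * i + 1 ≤ 2 * m by omega), hlt (show 2 * i + 2 ≤ 2 * m by omega)]
        using h022 i hi
    · simp only [hge (show 2 * m ≤ 2 * i + 1 by omega), hge (show 2 * m ≤ 2 * i + 2 by omega)]

theorem exists_forall_hasSortwiseJonssonTerms_iff :
    (∃ n, ∀ s, M.HasSortwiseJonssonTerms s n) ↔ ∀ s, ∃ n, M.HasSortwiseJonssonTerms s n := by
  refine ⟨fun ⟨n, h⟩ s => ⟨n, h s⟩, fun h => ?_⟩
  choose n hn using h
  obtain ⟨N, hN⟩ := (Set.finite_range n).bddAbove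
  exact ⟨N, fun s => (hn s).mono (hN ⟨s, rfl⟩)⟩

/-- The operation of sort `3s → s` obtained from one of sort `(3 × S, p₂, s)` by replacing the
variable `(i, t)` with `u_t(π_i)`. -/
noncomputable def diagonalize {s : S} (u : (t : S) → M.Op (fun _ : Fin 1 => s) t)
    (f : M.OpThree s) :
    M.Op (fun _ : Fin 3 => s) s :=
  M.comp f fun a => M.comp (u ((Finite.equivFin (Fin 3 × S)).symm a).2)
    fun _ => M.proj (fun _ : Fin 3 => s) ((Finite.equivFin (Fin 3 × S)).symm a).1

theorem comp_projThree {s t : S} (g : (x : Fin 3 × S) → M.Op (fun _ : Fin 3 => s) x.2)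
    (i : Fin 3) :
    M.comp (M.projThree i t) (fun a => g ((Finite.equivFin (Fin 3 × S)).symm a)) = g (i, t) := by
  have key : ∀ x : Fin 3 × S, M.comp (M.projOn (fun x : Fin 3 × S => x.2) x)
      (fun a => g ((Finite.equivFin (Fin 3 × S)).symm a)) = g x := by
    intro x
    obtain ⟨a, rfl⟩ := (Finite.equivFin (Fin 3 × S)).symm.surjective x
    rw [projOn_symm]
    exact M.proj_comp a _
  exact key (i, t)

theorem diagonalize_projThree {s : S} {u : (t : S) → M.Op (fun _ : Fin 1 => s) t}
    (hu : u s = M.proj (fun _ : Fin 1 => s) 0) (i : Fin 3) :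
    diagonalize u (M.projThree i s) = M.proj (fun _ : Fin 3 => s) i := by
  refine (comp_projThree
    (fun x => M.comp (u x.2) fun _ => M.proj (fun _ : Fin 3 => s) x.1) i).trans ?_
  simp only [hu]
  exact M.proj_comp (v := fun _ : Fin 1 => s) 0 _

/-- Both sides replace `(l, t)` by `u_t` of the projection with index `![i, j, k] l`. -/
theorem subst_diagonalize {s : S} (u : (t : S) → M.Op (fun _ : Fin 1 => s) t) (f : M.OpThree s)
    (i j k : Fin 3) :
    M.subst (diagonalize u f) i j k = diagonalize u (M.substThree f i j k) := by
  unfold subst diagonalize substThree compOn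
  rw [← M.assoc, ← M.assoc]
  refine congrArg (M.comp f) (funext fun a => ?_)
  rw [comp_projThree (fun x => M.comp (u x.2) fun _ => M.proj (fun _ : Fin 3 => s) x.1),
    ← M.assoc]
  refine congrArg (M.comp _) (funext fun _ => ?_)
  exact M.proj_comp (v := fun _ : Fin 3 => s) _ _

theorem HasSortwiseJonssonTerms.hasJonssonTerms (hM : M.IsPure) {s : S} {n : ℕ}
    (h : M.HasSortwiseJonssonTerms s n) : M.HasJonssonTerms s n := by
  -- `u s` must be the identity for the end terms to become the projections `π_0` and `π_2`.
  obtain ⟨u, hu⟩ : ∃ u : (t : S) → M.Op (fun _ : Fin 1 => s) t,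
      u s = M.proj (fun _ : Fin 1 => s) 0 := by
    classical
    exact ⟨Function.update (fun t => (hM s t).some) s (M.proj (fun _ : Fin 1 => s) 0), by simp⟩
  obtain ⟨d, h0, hn, h010, h002, h022⟩ := h
  refine ⟨fun i => diagonalize u (d i), ?_, ?_, fun i hi => ?_, fun i hi => ?_, fun i hi => ?_⟩
  · simp only [h0, diagonalize_projThree hu]
  · simp only [hn, diagonalize_projThree hu]
  · simp only [subst_diagonalize, h010 i hi]
  · simp only [subst_diagonalize, h002 i hi]
  · simp only [subst_diagonalize, h022 i hi]

theorem HasJonssonTerms.hasSortwiseJonssonTerms {s : S} {n : ℕ} (h : M.HasJonssonTerms s n) :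
    M.HasSortwiseJonssonTerms s n := by
  let E (f : M.Op (fun _ : Fin 3 => s) s) : M.OpThree s := M.comp f fun i => M.projThree i s
  have hE (i : Fin 3) : E (M.proj (fun _ : Fin 3 => s) i) = M.projThree i s :=
    M.proj_comp (v := fun _ : Fin 3 => s) i _
  have hsubst (f) (i j k : Fin 3) : M.substThree (E f) i j k = E (M.subst f i j k) := by
    simp only [E]
    unfold substThree subst compOn
    rw [← M.assoc, ← M.assoc]
    refine congrArg (M.comp f) (funext fun a => ?_)
    refine Eq.trans ?_ (M.proj_comp (v := fun _ : Fin 3 => s) _ _).symm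
    exact M.projOn_compOn (v := fun x : Fin 3 × S => x.2) (a, s)
      (fun x => M.projThree (![i, j, k] x.1) x.2)
  obtain ⟨d, h0, hn, h010, h002, h022⟩ := h
  refine ⟨fun i => E (d i), ?_, ?_, fun i hi => ?_, fun i hi => ?_, fun i hi => ?_⟩
  · simp only [h0, hE]
  · simp only [hn, hE]
  · simp only [hsubst, h010 i hi]
  · simp only [hsubst, h002 i hi]
  · simp only [hsubst, h022 i hi]

end Sortwise

end Clone

end ManySorted

theorem mainTheorem8 {S : Type u} [Finite S] (M : ManySorted.Clone.{u, v} S) (hM : M.IsPure) :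
    List.TFAE [
      ManySorted.Clone.CongruenceDistributive.{u, v, max u v w} M,
      ManySorted.Clone.CongruenceDistributive.{0, max u v, max u v w} M.homogenization,
      ∃ n : ℕ, M.homogenization.HasJonssonTerms () n,
      ∃ n : ℕ, ∀ s : S, M.HasSortwiseJonssonTerms s n,
      ∀ s : S, ∃ n : ℕ, M.HasSortwiseJonssonTerms s n,
      ∀ s : S, ∃ n : ℕ, M.HasJonssonTerms s n] := by
  -- The parameter `max u w` puts the algebras of `M` in the same universe as those of `H(M)`, whose
  -- operations live in `max u v`.
  tfae_have 1 ↔ 6 := ManySorted.Clone.congruenceDistributive_iff.{u, v, max u w}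
  tfae_have 2 ↔ 3 :=
    (ManySorted.Clone.congruenceDistributive_iff.{0, max u v, w}).trans
      ⟨fun h => h (), fun h _ => h⟩
  tfae_have 3 ↔ 4 := exists_congr ManySorted.Clone.homogenization_hasJonssonTerms_iff
  tfae_have 4 ↔ 5 := ManySorted.Clone.exists_forall_hasSortwiseJonssonTerms_iff
  tfae_have 5 ↔ 6 := forall_congr' fun _ => exists_congr fun _ =>
    ⟨fun h => h.hasJonssonTerms hM, fun h => h.hasSortwiseJonssonTerms⟩
  tfae_finish
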